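/- **Proposition 8.5.** Let $d\ge 0$, let $R_d=\mathbb{Z}[u_1^{\pm1},\dots,u_d^{\pm1}]$ be the ring of Laurent polynomials in $d$ commuting variables, write $u^{\mathbf n}=u_1^{n_1}\cdots u_d^{n_d}$ for $\mathbf n\in\mathbb{Z}^d$, and let $\alpha_M$ denote the algebraic $\mathbb{Z}^d$-action dual to an $R_d$-module $M$. For a half-space $H=\{\mathbf x\in\mathbb{R}^d:\mathbf x\cdot\mathbf v\le 0\}$, where $\mathbf v\in\mathbb{R}^d$ is a unit vector, let $R_H=\mathbb{Z}[u^{\mathbf n}:\mathbf n\in H\cap\mathbb{Z}^d]$, a subring of $R_d$. Let $\mathsf{G}_k$ be the Grassmannian of $k$-dimensional linear subspaces of $\mathbb{R}^d$ with the topology given by the Hausdorff distance between the intersections of subspaces with the unit sphere. A Noetherian $R_d$-module $M$ is called *Noetherian along* $V\in\mathsf{G}_k$ if $M$ is Noetherian as an $R_H$-module for every such half-space $H$ containing $V$, and $\mathsf{N}^{\mathsf n}_k(\alpha_M)$ denotes the set of all $V\in\mathsf{G}_k$ along which $M$ is not Noetherian. Let $M$ be a Noetherian $R_d$-module, and let $0\le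 k\le d$ be such that the Krull dimension of $R_d/\mathfrak p$ is at most $k$ for every prime ideal $\mathfrak p$ associated to $M$ (that is, every prime ideal of the form $\mathfrak p=\{f\in R_d: f\cdot m=0\}$ with $m\in M$). Then $\mathsf{N}^{\mathsf n}_k(\alpha_M)$ is a closed subset of $\mathsf{G}_k$ with empty interior. -/

import Mathlib

/-- The ring `R_d = ℤ[u₁^{±1}, …, u_d^{±1}]` of Laurent polynomials in `d` commuting variables with
integer coefficients, i.e. the group ring of `ℤ^d`. -/
abbrev LaurentRing (d : ℕ) : Type := AddMonoidAlgebra ℤ (Fin d → ℤ)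

/-- The monomial `u^n`, for `n ∈ ℤ^d`. -/
noncomputable def LaurentRing.monomial {d : ℕ} (n : Fin d → ℤ) : LaurentRing d :=
  AddMonoidAlgebra.single n 1

/-- An integer vector `n ∈ ℤ^d`, seen as a point of Euclidean space `ℝ^d`. -/
noncomputable def latticePoint {d : ℕ} (n : Fin d → ℤ) : EuclideanSpace ℝ (Fin d) :=
  WithLp.toLp 2 (fun i => (n i : ℝ))

/-- The half-space `H_v = {x ∈ ℝ^d : x · v ≤ 0}` with outward normal `v`. The half-spaces of `ℝ^d`
are the sets `H_v` for `v` in the unit sphere. -/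
def halfSpace {d : ℕ} (v : EuclideanSpace ℝ (Fin d)) : Set (EuclideanSpace ℝ (Fin d)) :=
  {x | inner ℝ x v ≤ 0}

/-- For `F ⊆ ℝ^d` (here used with `F` a half-space `H`), the subring `R_F = ℤ[u^n : n ∈ F ∩ ℤ^d]`
of `R_d`. -/
noncomputable def latticeSubring {d : ℕ} (F : Set (EuclideanSpace ℝ (Fin d))) :
    Subalgebra ℤ (LaurentRing d) :=
  Algebra.adjoin ℤ {f | ∃ n : Fin d → ℤ, latticePoint n ∈ F ∧ f = LaurentRing.monomial n}

/-- `M` is `R_H`-Noetherian, where `H = H_v`: it is Noetherian as a module over the subring `R_H`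
of `R_d`, acting by restriction of scalars. -/
def IsHalfSpaceNoetherian {d : ℕ} (M : Type*) [AddCommGroup M] [Module (LaurentRing d) M]
    (v : EuclideanSpace ℝ (Fin d)) : Prop :=
  IsNoetherian (latticeSubring (halfSpace v)) M

/-- `M` is Noetherian along the subspace `V` of `ℝ^d`: it is `R_H`-Noetherian for every half-space
`H` containing `V`. -/
def IsNoetherianAlong {d : ℕ} (M : Type*) [AddCommGroup M] [Module (LaurentRing d) M]
    (V : Submodule ℝ (EuclideanSpace ℝ (Fin d))) : Prop :=
  ∀ v ∈ Metric.sphere (0 : EuclideanSpace ℝ (Fin d)) 1,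
    (V : Set (EuclideanSpace ℝ (Fin d))) ⊆ halfSpace v → IsHalfSpaceNoetherian M v

/-- The Grassmannian `G_k = G_{d,k}` of `k`-planes, i.e. `k`-dimensional linear subspaces
of `ℝ^d`. -/
def RealGrassmannian (d k : ℕ) : Type :=
  {V : Submodule ℝ (EuclideanSpace ℝ (Fin d)) // Module.finrank ℝ V = k}

/-- The distance of two `k`-planes is the Hausdorff distance of their intersections with the unit
sphere; the topology of `G_k` is the one of this distance. -/
noncomputable instance RealGrassmannian.instPseudoEMetricSpace (d k : ℕ) :
    PseudoEMetricSpace (RealGrassmannian d k) :=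
  PseudoEMetricSpace.induced
    (fun V => (V.1 : Set (EuclideanSpace ℝ (Fin d))) ∩ Metric.sphere 0 1)
    PseudoEMetricSpace.hausdorff

/-- The set `N^n_k(α_M)` of `k`-planes along which `M` is not Noetherian. -/
def nonNoetherianPlanes (d k : ℕ) (M : Type*) [AddCommGroup M] [Module (LaurentRing d) M] :
    Set (RealGrassmannian d k) :=
  {V | ¬ IsNoetherianAlong M V.1}

/-! For `v ≠ 0`, `M` is `R_H`-Noetherian iff its annihilator contains some `1 - g` with all
exponents of `g` in the open half-space `x · v < 0` (`isHalfSpaceNoetherian_iff`). Since `g` has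
finite support, this condition is open in `v`. The bad unit vectors are therefore closed, and
compactness of the sphere makes the bad planes closed (`isClosed_setOf_exists_subset_halfSpace`).

For the empty interior, a vector bad for `M` is bad for some associated prime `p`
(`exists_associatedPrime_not_hasContraction`). Badness yields a valuation on the fraction field of
`R_d ⧸ p` under which monomials of negative weight have value `< 1`; so a monomial of value `1` has
weight `0`. Variables whose weights `v i` are rationally independent then have multiplicatively
independent values. As in Abhyankar's inequality, their number is at most the Krull dimension, hence
at most `k` (`natCard_le_ringKrullDim_of_not_hasContraction`). So `v` lies in the column space of a
rational `d × k` matrix. There are countably many such spaces, each of dimension at most `k`. By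
Baire, arbitrarily near any plane there is a `V` with `Vᗮ` meeting all of them trivially. Every `v`
with `V ⊆ H_v` lies in `Vᗮ`, so none is bad for this `V`. -/

/-! ### Filtration of Laurent polynomials by weight. -/

/-- The pairing `n ↦ n · v` of `ℤ^d` with a vector `v ∈ ℝ^d`. -/
noncomputable def latticeWeight {d : ℕ} (v : EuclideanSpace ℝ (Fin d)) : (Fin d → ℤ) →+ ℝ where
  toFun n := inner ℝ (latticePoint n) v
  map_zero' := by
    have : latticePoint (0 : Fin d → ℤ) = 0 := by ext i; simp [latticePoint]
    rw [this, inner_zero_left]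
  map_add' m n := by
    have : latticePoint (m + n) = latticePoint m + latticePoint n := by
      ext i; simp [latticePoint]
    rw [this, inner_add_left]

lemma latticeWeight_eq_sum {d : ℕ} (v : EuclideanSpace ℝ (Fin d)) (n : Fin d → ℤ) :
    latticeWeight v n = ∑ i, (n i : ℝ) * v i := by
  simp [latticeWeight, latticePoint, PiLp.inner_apply, mul_comm]

lemma continuous_latticeWeight {d : ℕ} (n : Fin d → ℤ) :
    Continuous fun v : EuclideanSpace ℝ (Fin d) => latticeWeight v n :=
  continuous_const.inner continuous_id

/-- The Laurent polynomials all of whose exponents `n` satisfy `n · v ≤ c`. -/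
noncomputable def weightLE {d : ℕ} (v : EuclideanSpace ℝ (Fin d)) (c : ℝ) :
    AddSubgroup (LaurentRing d) where
  carrier := {f | ∀ n ∈ f.coeff.support, latticeWeight v n ≤ c}
  zero_mem' := by simp
  add_mem' := by
    classical
    intro f g hf hg n hn
    rw [AddMonoidAlgebra.coeff_add] at hn
    rcases Finset.mem_union.1 (Finsupp.support_add hn) with h | h
    exacts [hf n h, hg n h]
  neg_mem' := by
    intro f hf n hn
    apply hf n
    simpa using hn

namespace weightLE

variable {d : ℕ} {v : EuclideanSpace ℝ (Fin d)}

lemma mono {a b : ℝ} (h : a ≤ b) {f : LaurentRing d} (hf : f ∈ weightLE v a) :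
    f ∈ weightLE v b := fun n hn => (hf n hn).trans h

lemma mul_mem {a b : ℝ} {f g : LaurentRing d} (hf : f ∈ weightLE v a) (hg : g ∈ weightLE v b) :
    f * g ∈ weightLE v (a + b) := by
  classical
  intro n hn
  obtain ⟨p, hp, q, hq, rfl⟩ := Finset.mem_add.1
    (AddMonoidAlgebra.support_coeff_mul_subset f g hn)
  rw [map_add]
  exact add_le_add (hf p hp) (hg q hq)

lemma single_mem {n : Fin d → ℤ} (a : ℤ) {c : ℝ} (h : latticeWeight v n ≤ c) :
    AddMonoidAlgebra.single n a ∈ weightLE v c := by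
  intro m hm
  have := Finsupp.support_single_subset (by simpa using hm : m ∈ (Finsupp.single n a).support)
  rw [Finset.mem_singleton] at this
  rwa [this]

lemma one_mem : (1 : LaurentRing d) ∈ weightLE v 0 := by
  rw [AddMonoidAlgebra.one_def]
  exact single_mem 1 (by simp)

lemma pow_mem {a : ℝ} {f : LaurentRing d} (hf : f ∈ weightLE v a) (N : ℕ) :
    f ^ N ∈ weightLE v (N * a) := by
  induction N with
  | zero => simpa using one_mem
  | succ N ih =>
    rw [pow_succ]
    have h : ((N + 1 : ℕ) : ℝ) * a = N * a + a := by push_cast; ring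
    rw [h]
    exact mul_mem ih hf

lemma exists_mem (v : EuclideanSpace ℝ (Fin d)) (f : LaurentRing d) : ∃ c, f ∈ weightLE v c := by
  obtain ⟨c, hc⟩ := (f.coeff.support.image (latticeWeight v)).bddAbove
  exact ⟨c, fun n hn => hc (by simpa using ⟨n, by simpa using hn, rfl⟩)⟩

end weightLE

lemma mem_latticeSubring_halfSpace {d : ℕ} {v : EuclideanSpace ℝ (Fin d)} {f : LaurentRing d} :
    f ∈ latticeSubring (halfSpace v) ↔ f ∈ weightLE v 0 := by
  constructor
  · intro hf
    refine Algebra.adjoin_induction (p := fun f _ => f ∈ weightLE v 0) ?_ ?_ ?_ ?_ hf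
    · rintro _ ⟨n, hn, rfl⟩
      exact weightLE.single_mem 1 hn
    · intro r
      rw [Algebra.algebraMap_eq_smul_one]
      exact AddSubgroup.zsmul_mem _ weightLE.one_mem r
    · intro f g _ _
      exact add_mem
    · intro f g _ _ hf hg
      simpa using weightLE.mul_mem hf hg
  · intro hf
    have key : f = ∑ n ∈ f.coeff.support, f.coeff n • LaurentRing.monomial n := by
      apply AddMonoidAlgebra.ext
      conv_lhs => rw [← Finsupp.sum_single f.coeff]
      simp [Finsupp.sum, LaurentRing.monomial]
    rw [key]
    refine Subalgebra.sum_mem _ fun n hn => Subalgebra.smul_mem _ ?_ _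
    exact Algebra.subset_adjoin ⟨n, hf n hn, rfl⟩

/-! ### The contraction criterion for half-space Noetherianity. -/

/-- The ideal `I` contains an element `1 - g` such that all exponents of `g` lie in the open
half-space `{x | x · v < 0}`. -/
def HasContraction {d : ℕ} (I : Ideal (LaurentRing d)) (v : EuclideanSpace ℝ (Fin d)) : Prop :=
  ∃ g : LaurentRing d, (∀ n ∈ g.coeff.support, latticeWeight v n < 0) ∧ 1 - g ∈ I

lemma isOpen_setOf_hasContraction {d : ℕ} (I : Ideal (LaurentRing d)) :
    IsOpen {v | HasContraction I v} := by
  have : {v | HasContraction I v} = ⋃ g ∈ {g : LaurentRing d | 1 - g ∈ I},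
      ⋂ n ∈ g.coeff.support, {v | latticeWeight v n < 0} := by
    ext v
    simp only [HasContraction, Set.mem_ofPred_eq, Set.mem_iUnion, Set.mem_iInter, exists_prop]
    exact exists_congr fun g => and_comm
  rw [this]
  refine isOpen_biUnion fun g _ => isOpen_biInter_finset fun n _ => ?_
  exact isOpen_lt (continuous_latticeWeight n) continuous_const

lemma exists_weightLE_neg {d : ℕ} {v : EuclideanSpace ℝ (Fin d)} {g : LaurentRing d}
    (hg : ∀ n ∈ g.coeff.support, latticeWeight v n < 0) : ∃ c < 0, g ∈ weightLE v c := by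
  rcases g.coeff.support.eq_empty_or_nonempty with h | h
  · exact ⟨-1, by norm_num, fun n hn => by simp [h] at hn⟩
  · obtain ⟨n, hn, hmax⟩ := Finset.exists_max_image _ (latticeWeight v) h
    exact ⟨latticeWeight v n, hg n hn, hmax⟩

/-- The ideal of the half-space ring `R_H` spanned by the monomials in the open half-space. -/
noncomputable def openHalfSpaceIdeal {d : ℕ} (v : EuclideanSpace ℝ (Fin d)) :
    Ideal (latticeSubring (halfSpace v)) where
  carrier := {f | ∃ c < 0, (f : LaurentRing d) ∈ weightLE v c}
  zero_mem' := ⟨-1, by norm_num, zero_mem _⟩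
  add_mem' := by
    rintro f g ⟨a, ha, hf⟩ ⟨b, hb, hg⟩
    exact ⟨max a b, max_lt ha hb, add_mem (weightLE.mono (le_max_left _ _) hf)
      (weightLE.mono (le_max_right _ _) hg)⟩
  smul_mem' := by
    rintro b f ⟨a, ha, hf⟩
    refine ⟨a, ha, ?_⟩
    simpa using weightLE.mul_mem (mem_latticeSubring_halfSpace.1 b.2) hf

lemma hasContraction_of_sub_one_mem {d : ℕ} {I : Ideal (LaurentRing d)}
    {v : EuclideanSpace ℝ (Fin d)} {r : latticeSubring (halfSpace v)}
    (hr : r - 1 ∈ openHalfSpaceIdeal v) (hI : (r : LaurentRing d) ∈ I) : HasContraction I v := by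
  obtain ⟨c, hc, h⟩ := hr
  refine ⟨1 - r, fun n hn => ?_, by simpa using hI⟩
  have : (1 : LaurentRing d) - r ∈ weightLE v c := by
    rw [← neg_sub]
    exact neg_mem h
  exact (this n hn).trans_lt hc

lemma exists_latticeWeight_neg {d : ℕ} {v : EuclideanSpace ℝ (Fin d)} (hv : v ≠ 0) :
    ∃ n, latticeWeight v n < 0 := by
  by_contra! h
  apply hv
  ext i
  have h1 := h (Pi.single i 1)
  have h2 := h (-Pi.single i 1)
  rw [map_neg] at h2
  have : latticeWeight v (Pi.single i 1) = v i := by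
    rw [latticeWeight_eq_sum, Finset.sum_eq_single i] <;> simp +contextual
  rw [this] at h1 h2
  simp only [PiLp.zero_apply]
  linarith

lemma monomial_mul_monomial_neg {d : ℕ} (n : Fin d → ℤ) :
    LaurentRing.monomial n * LaurentRing.monomial (-n) = 1 := by
  rw [LaurentRing.monomial, LaurentRing.monomial, AddMonoidAlgebra.single_mul_single,
    AddMonoidAlgebra.one_def]
  simp

section Criterion

variable {d : ℕ} {M : Type*} [AddCommGroup M] [Module (LaurentRing d) M]
  {v : EuclideanSpace ℝ (Fin d)}

/-- Nakayama's lemma for `openHalfSpaceIdeal v`: a monomial of negative weight is invertible in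
`R_d`, so this ideal times `M` is all of `M`. -/
lemma IsHalfSpaceNoetherian.hasContraction (hM : IsHalfSpaceNoetherian M v) (hv : v ≠ 0) :
    HasContraction (Module.annihilator (LaurentRing d) M) v := by
  have hM' : IsNoetherian (latticeSubring (halfSpace v)) M := hM
  obtain ⟨n, hn⟩ := exists_latticeWeight_neg hv
  have hmem : LaurentRing.monomial n ∈ latticeSubring (halfSpace v) :=
    mem_latticeSubring_halfSpace.2 (weightLE.single_mem 1 hn.le)
  have hle : (⊤ : Submodule (latticeSubring (halfSpace v)) M) ≤ openHalfSpaceIdeal v • ⊤ := by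
    intro m _
    have : m = (⟨_, hmem⟩ : latticeSubring (halfSpace v)) •
        (LaurentRing.monomial (-n) : LaurentRing d) • m := by
      rw [Subalgebra.smul_def, smul_smul, monomial_mul_monomial_neg, one_smul]
    rw [this]
    exact Submodule.smul_mem_smul ⟨_, hn, weightLE.single_mem 1 le_rfl⟩ trivial
  obtain ⟨r, hr, hr'⟩ := Submodule.exists_sub_one_mem_and_smul_eq_zero_of_fg_of_le_smul
    _ _ (IsNoetherian.noetherian ⊤) hle
  exact hasContraction_of_sub_one_mem hr
    (Module.mem_annihilator.2 fun m => by simpa [Subalgebra.smul_def] using hr' m trivial)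

/-- Modulo `I`, `g` is `1`, so multiplying `f` by a high power of `g` keeps its class while pushing
its exponents into the half-space. -/
lemma exists_mem_latticeSubring_sub_mem {I : Ideal (LaurentRing d)} (h : HasContraction I v)
    (f : LaurentRing d) : ∃ b ∈ latticeSubring (halfSpace v), f - b ∈ I := by
  obtain ⟨g, hg, hI⟩ := h
  obtain ⟨c, hc, hgc⟩ := exists_weightLE_neg hg
  obtain ⟨a, ha⟩ := weightLE.exists_mem v f
  obtain ⟨N, hN⟩ := exists_nat_ge (a / -c)
  refine ⟨f * g ^ N, mem_latticeSubring_halfSpace.2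
    (weightLE.mono ?_ (weightLE.mul_mem ha (weightLE.pow_mem hgc N))), ?_⟩
  · rw [div_le_iff₀ (by linarith)] at hN
    linarith
  · have h1 : 1 - g ^ N ∈ I := by
      have := sub_dvd_pow_sub_pow 1 g N
      rw [one_pow] at this
      exact I.mem_of_dvd this hI
    have : f - f * g ^ N = f * (1 - g ^ N) := by ring
    rw [this]
    exact I.mul_mem_left _ h1

/-- Every Laurent polynomial acts on `M` as an element of `R_H`, so `R_H`-submodules are already
`R_d`-submodules. -/
lemma HasContraction.isHalfSpaceNoetherian [IsNoetherian (LaurentRing d) M]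
    (h : HasContraction (Module.annihilator (LaurentRing d) M) v) :
    IsHalfSpaceNoetherian M v := by
  let extend (N : Submodule (latticeSubring (halfSpace v)) M) : Submodule (LaurentRing d) M :=
    { N with
      smul_mem' := fun f x hx => by
        obtain ⟨b, hb, hfb⟩ := exists_mem_latticeSubring_sub_mem h f
        have := Module.mem_annihilator.1 hfb x
        rw [sub_smul, sub_eq_zero] at this
        rw [this]
        exact N.smul_mem ⟨b, hb⟩ hx }
  have hmono : StrictMono extend := by
    intro N N' hlt
    exact lt_of_le_not_ge (fun x hx => hlt.le hx) fun hle => hlt.not_ge fun x hx => hle hx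
  rw [IsHalfSpaceNoetherian, isNoetherian_iff']
  exact hmono.wellFoundedGT

lemma isHalfSpaceNoetherian_iff [IsNoetherian (LaurentRing d) M] (hv : v ≠ 0) :
    IsHalfSpaceNoetherian M v ↔ HasContraction (Module.annihilator (LaurentRing d) M) v :=
  ⟨fun h => h.hasContraction hv, fun h => h.isHalfSpaceNoetherian⟩

end Criterion

/-! ### Reduction to associated primes. -/

/-- The elements `1 - g` with all exponents of `g` in the open half-space `{x | x · v < 0}`. -/
noncomputable def contractionSubmonoid {d : ℕ} (v : EuclideanSpace ℝ (Fin d)) :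
    Submonoid (LaurentRing d) where
  carrier := {f | ∃ c < 0, 1 - f ∈ weightLE v c}
  one_mem' := ⟨-1, by norm_num, by simp⟩
  mul_mem' := by
    rintro f g ⟨a, ha, hf⟩ ⟨b, hb, hg⟩
    refine ⟨max a b, max_lt ha hb, ?_⟩
    have h : 1 - f * g = (1 - f) + (1 - g) - (1 - f) * (1 - g) := by ring
    rw [h]
    refine sub_mem (add_mem (weightLE.mono (le_max_left _ _) hf)
      (weightLE.mono (le_max_right _ _) hg)) (weightLE.mono ?_ (weightLE.mul_mem hf hg))
    exact le_trans (by linarith) (le_max_left _ _)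

lemma hasContraction_iff_not_disjoint {d : ℕ} {I : Ideal (LaurentRing d)}
    {v : EuclideanSpace ℝ (Fin d)} :
    HasContraction I v ↔ ¬ Disjoint (I : Set (LaurentRing d)) (contractionSubmonoid v) := by
  rw [Set.not_disjoint_iff]
  constructor
  · rintro ⟨g, hg, hI⟩
    obtain ⟨c, hc, h⟩ := exists_weightLE_neg hg
    exact ⟨1 - g, hI, c, hc, by rwa [sub_sub_cancel]⟩
  · rintro ⟨f, hI, c, hc, hf⟩
    exact ⟨1 - f, fun n hn => (hf n hn).trans_lt hc, by simpa using hI⟩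

lemma exists_associatedPrime_not_hasContraction {d : ℕ} {M : Type*} [AddCommGroup M]
    [Module (LaurentRing d) M] [IsNoetherian (LaurentRing d) M] [IsNoetherianRing (LaurentRing d)]
    {v : EuclideanSpace ℝ (Fin d)}
    (h : ¬ HasContraction (Module.annihilator (LaurentRing d) M) v) :
    ∃ p ∈ associatedPrimes (LaurentRing d) M, ¬ HasContraction p v := by
  rw [hasContraction_iff_not_disjoint, not_not] at h
  -- Primes minimal over the annihilator are associated, and shrinking `P` to one of them keeps it
  -- disjoint from the submonoid.
  obtain ⟨P, hP, hle, hdisj⟩ := Ideal.exists_le_prime_disjoint _ _ h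
  obtain ⟨p, hp, hpP⟩ := Ideal.exists_minimalPrimes_le hle
  refine ⟨p, Module.associatedPrimes.minimalPrimes_annihilator_subset_associatedPrimes _ _ hp, ?_⟩
  rw [hasContraction_iff_not_disjoint, not_not]
  exact hdisj.mono_left hpP

/-! ### Krull dimension bounds from algebraic independence. -/

instance {d : ℕ} : Algebra.FiniteType ℤ (LaurentRing d) :=
  AddMonoidAlgebra.finiteType_of_fg _ _

instance {d : ℕ} : IsNoetherianRing (LaurentRing d) :=
  Algebra.FiniteType.isNoetherianRing ℤ _

lemma ringKrullDim_le_of_isIntegral {R S : Type*} [CommRing R] [CommRing S] [IsDomain R]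
    [Nontrivial S] [Algebra R S] [Algebra.IsIntegral R S]
    (h : Function.Injective (algebraMap R S)) : ringKrullDim R ≤ ringKrullDim S := by
  refine iSup_le fun l => ?_
  obtain ⟨P, -, hP, hPl⟩ := Ideal.exists_ideal_over_prime_of_isIntegral l.head.asIdeal
    (⊥ : Ideal S) (by rw [← RingHom.ker_eq_comap_bot, (RingHom.injective_iff_ker_eq_bot _).1 h]
                      exact bot_le)
  have : P.LiesOver l.head.asIdeal := ⟨hPl.symm⟩
  obtain ⟨L, hL, -⟩ := Ideal.exists_ltSeries_of_hasGoingUp l P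
  rw [← hL]
  exact le_iSup (fun L : LTSeries (PrimeSpectrum S) => (L.length : WithBot ℕ∞)) L

/-- By Noether normalization `A` is integral over a polynomial ring in `s` variables, where `s` is
the transcendence degree. -/
lemma natCard_le_ringKrullDim_of_algebraicIndependent {F A ι : Type*} [Field F] [CommRing A]
    [IsDomain A] [Algebra F A] [Algebra.FiniteType F A] [Finite ι] {x : ι → A}
    (hx : AlgebraicIndependent F x) : (Nat.card ι : WithBot ℕ∞) ≤ ringKrullDim A := by
  obtain ⟨s, g, hg, hint⟩ := exists_integral_inj_algHom_of_fg F A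
  let _ : Algebra (MvPolynomial (Fin s) F) A := g.toRingHom.toAlgebra
  have : IsScalarTower F (MvPolynomial (Fin s) F) A :=
    IsScalarTower.of_algebraMap_eq fun c => (g.commutes c).symm
  have : Algebra.IsIntegral (MvPolynomial (Fin s) F) A := ⟨hint⟩
  have hinj : Function.Injective (algebraMap (MvPolynomial (Fin s) F) A) := hg
  have : FaithfulSMul (MvPolynomial (Fin s) F) A := (faithfulSMul_iff_algebraMap_injective _ _).2 hg
  have hdim := ringKrullDim_le_of_isIntegral hinj
  rw [MvPolynomial.ringKrullDim_of_isNoetherianRing, ringKrullDim_eq_zero_of_field, zero_add,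
    Nat.card_eq_fintype_card, Fintype.card_fin] at hdim
  refine le_trans ?_ hdim
  have h1 := hx.lift_cardinalMk_le_trdeg
  have h2 := lift_trdeg_add_eq F (MvPolynomial (Fin s) F) A
  rw [trdeg_eq_zero (R := MvPolynomial (Fin s) F) (A := A),
    MvPolynomial.trdeg_of_isDomain] at h2
  simp only [Cardinal.mk_fin, Cardinal.lift_natCast, Cardinal.lift_zero, add_zero] at h2
  have h3 : Algebra.trdeg F A = (s : Cardinal) := by
    rw [← Cardinal.lift_inj, ← h2]; simp
  rw [h3, Cardinal.lift_natCast, ← Nat.cast_card, Cardinal.lift_natCast] at h1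
  exact_mod_cast h1

instance Int.isJacobsonRing : IsJacobsonRing ℤ := by
  rw [isJacobsonRing_iff_prime_eq]
  intro P hP
  by_cases h : P = ⊥
  · subst h
    refine le_antisymm (fun x hx => ?_) Ideal.le_jacobson
    have h1 := Ideal.mem_jacobson_bot.1 hx x
    rw [Int.isUnit_iff] at h1
    rw [Ideal.mem_bot]
    rcases h1 with h1 | h1 <;> nlinarith [mul_self_nonneg x]
  · exact @Ideal.jacobson_eq_self_of_isMaximal _ _ _ (hP.isMaximal h)

/-- As `ℤ` is Jacobson, a residue field of finite type would be finite over `ℤ`; containing `ℤ`, it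
would force `ℤ` to be a field. -/
lemma not_isMaximal_of_comap_int_eq_bot {A : Type*} [CommRing A] [Algebra.FiniteType ℤ A]
    {P : Ideal A} (hP : ∀ n : ℤ, (n : A) ∈ P → n = 0) : ¬ P.IsMaximal := by
  intro hmax
  let _ : Field (A ⧸ P) := Ideal.Quotient.field P
  have := finite_of_finite_type_of_isJacobsonRing ℤ (A ⧸ P)
  refine Int.not_isField (isField_of_isIntegral_of_isField (R := ℤ) (S := A ⧸ P) ?_
    (Field.toIsField _))
  rw [injective_iff_map_eq_zero]
  intro n hn
  apply hP
  rw [← Ideal.Quotient.eq_zero_iff_mem]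
  simpa using hn

open TensorProduct in
-- A long chain of primes in `ℚ ⊗ A` contracts to `A`. Its top contains no nonzero integer, so it is
-- not maximal and the chain extends by one.
lemma natCard_add_one_le_ringKrullDim_of_algebraicIndependent {A K ι : Type*} [CommRing A]
    [IsDomain A] [Algebra.FiniteType ℤ A] [Field K] [Algebra ℚ K] [Algebra A K]
    [FaithfulSMul A K] [Finite ι] {x : ι → A}
    (hx : AlgebraicIndependent ℚ (fun i => algebraMap A K (x i))) :
    (Nat.card ι : WithBot ℕ∞) + 1 ≤ ringKrullDim A := by
  have hinjA : Function.Injective (algebraMap A K) := FaithfulSMul.algebraMap_injective A K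
  have : CharZero K := algebraRat.charZero K
  have : CharZero A := charZero_of_inj_zero fun n hn => by
    have h := congrArg (algebraMap A K) hn
    simpa using h
  let _ : Algebra A (ℚ ⊗[ℤ] A) := Algebra.TensorProduct.rightAlgebra
  let S := Algebra.algebraMapSubmonoid A (nonZeroDivisors ℤ)
  have hloc : IsLocalization S (ℚ ⊗[ℤ] A) := IsLocalization.tensorRight ..
  have hS : S ≤ nonZeroDivisors A := by
    rintro _ ⟨n, hn, rfl⟩
    simpa using nonZeroDivisors.ne_zero hn
  have : IsDomain (ℚ ⊗[ℤ] A) := IsLocalization.isDomain_of_le_nonZeroDivisors _ hS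
  let φ : ℚ ⊗[ℤ] A →ₐ[ℚ] K := Algebra.TensorProduct.lift (Algebra.ofId ℚ K)
    ((algebraMap A K).toIntAlgHom) (fun _ _ => Commute.all _ _)
  have hx' : AlgebraicIndependent ℚ (fun i => (1 ⊗ₜ x i : ℚ ⊗[ℤ] A)) := by
    apply AlgebraicIndependent.of_comp φ
    convert hx using 2 with i
    simp [φ]
  have hdim := natCard_le_ringKrullDim_of_algebraicIndependent hx'
  obtain ⟨l, hl⟩ := Order.le_krullDim_iff.1 hdim
  let l' : LTSeries (PrimeSpectrum A) := l.map (PrimeSpectrum.comap (algebraMap A (ℚ ⊗[ℤ] A)))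
    (Monotone.strictMono_of_injective (fun _ _ h => Ideal.comap_mono h)
      (PrimeSpectrum.localization_comap_injective _ S))
  have hnot : ¬ l'.last.asIdeal.IsMaximal := by
    apply not_isMaximal_of_comap_int_eq_bot
    intro n hn
    by_contra h0
    have h1 : algebraMap A (ℚ ⊗[ℤ] A) (n : A) ∈ l.last.asIdeal := by
      rw [LTSeries.last_map] at hn
      exact hn
    have h2 : IsUnit (algebraMap A (ℚ ⊗[ℤ] A) (n : A)) :=
      IsLocalization.map_units (ℚ ⊗[ℤ] A)
        (⟨n, n, mem_nonZeroDivisors_of_ne_zero h0, by simp⟩ : S)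
    exact l.last.isPrime.ne_top (Ideal.eq_top_of_isUnit_mem _ h1 h2)
  obtain ⟨m, hm, hle⟩ := Ideal.exists_le_maximal _ l'.last.isPrime.ne_top
  have hlt : l'.last < ⟨m, hm.isPrime⟩ := by
    refine lt_of_le_of_ne hle fun h => hnot ?_
    rw [h]
    exact hm
  have h := le_iSup (fun L : LTSeries (PrimeSpectrum A) => (L.length : WithBot ℕ∞)) (l'.snoc _ hlt)
  refine le_trans (le_of_eq ?_) h
  have : (l'.snoc _ hlt).length = Nat.card ι + 1 := by simp [l', hl]
  simp only [this]
  push_cast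
  rfl

/-! ### Values of monomials and algebraic independence. -/

section Valuation

variable {K Γ₀ κ : Type*} [Field K] [LinearOrderedCommGroupWithZero Γ₀] (w : Valuation K Γ₀)

/-- If the nonzero constants have values in the powers of `τ`, and no nontrivial Laurent monomial in
the `x j` has such a value, then the `x j` are algebraically independent. -/
lemma algebraicIndependent_of_valuation {F : Type*} [Field F] [Algebra F K] [Fintype κ] {τ : Γ₀}
    (hτ : τ ≠ 0) {x : κ → K} (hx : ∀ j, x j ≠ 0)
    (hF : ∀ c : F, c ≠ 0 → ∃ a : ℤ, w (algebraMap F K c) = τ ^ a)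
    (hind : ∀ (n : κ → ℤ) (a : ℤ), w (∏ j, x j ^ n j) = τ ^ a → n = 0) :
    AlgebraicIndependent F x := by
  classical
  rw [algebraicIndependent_iff]
  intro p hp
  by_contra hp0
  let t : (κ →₀ ℕ) → K := fun m => algebraMap F K (p.coeff m) * ∏ j, x j ^ m j
  have hsum : ∑ m ∈ p.support, t m = 0 := by
    rw [← hp, MvPolynomial.aeval_def, MvPolynomial.eval₂_eq']
  have hne : p.support.Nonempty := MvPolynomial.support_nonempty.2 hp0
  have htne : ∀ m ∈ p.support, t m ≠ 0 := by
    intro m hm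
    refine mul_ne_zero ?_ (Finset.prod_ne_zero_iff.2 fun j _ => pow_ne_zero _ (hx j))
    simpa using hm
  -- Distinct terms have distinct values, so the largest one determines the value of the sum, which
  -- cannot vanish.
  have hinj : ∀ m ∈ p.support, ∀ m' ∈ p.support, w (t m) = w (t m') → m = m' := by
    intro m hm m' hm' h
    obtain ⟨a, ha⟩ := hF _ (MvPolynomial.mem_support_iff.1 hm)
    obtain ⟨a', ha'⟩ := hF _ (MvPolynomial.mem_support_iff.1 hm')
    simp only [t, map_mul, ha, ha'] at h
    have hprod : ∏ j, x j ^ ((m j : ℤ) - m' j) = (∏ j, x j ^ m j) / ∏ j, x j ^ m' j := by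
      rw [← Finset.prod_div_distrib]
      exact Finset.prod_congr rfl fun j _ => by rw [zpow_sub₀ (hx j)]; simp
    have hn := hind (fun j => (m j : ℤ) - m' j) (a' - a) (by
      have h1 : w (∏ j, x j ^ m' j) ≠ 0 := by
        rw [Valuation.ne_zero_iff]
        exact Finset.prod_ne_zero_iff.2 fun j _ => pow_ne_zero _ (hx j)
      rw [hprod, map_div₀, zpow_sub₀ hτ, div_eq_div_iff h1 (zpow_ne_zero _ hτ), mul_comm, h])
    ext j
    have := congrFun hn j
    simp only [Pi.zero_apply] at this
    lia
  obtain ⟨m, hm, hmax⟩ := Finset.exists_max_image p.support (fun m => w (t m)) hne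
  have hval : w (∑ m ∈ p.support, t m) = w (t m) := by
    refine w.map_sum_eq_of_lt hm fun i hi => ?_
    rw [Finset.mem_sdiff, Finset.mem_singleton] at hi
    exact lt_of_le_of_ne (hmax i hi.1) fun h => hi.2 (hinj i hi.1 m hm h)
  rw [hsum, map_zero] at hval
  exact htne m hm ((Valuation.zero_iff w).1 hval.symm)

/-- The integers of value `< 1` form an ideal `(q)`; take `τ = w q`, or `τ = 1` if `q = 0`. -/
lemma exists_valuation_intCast_eq_pow [CharZero K] (hw : ∀ n : ℤ, w n ≤ 1) :
    ∃ τ : Γ₀, τ ≠ 0 ∧ ∀ c : ℤ, c ≠ 0 → ∃ a : ℕ, w c = τ ^ a := by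
  let I : Ideal ℤ :=
    { carrier := {c | w c < 1}
      zero_mem' := by simp
      add_mem' := fun {a b} ha hb => by
        have := w.map_add_lt (x := (a : K)) (y := b) ha hb
        simpa using this
      smul_mem' := fun a b hb => by
        have := mul_lt_mul_of_le_of_lt_of_nonneg_of_pos (hw a) hb zero_le zero_lt_one
        simpa using this }
  have hI : ∀ c : ℤ, c ∉ I → w c = 1 := fun c hc => le_antisymm (hw c) (not_lt.1 hc)
  obtain ⟨q, hq⟩ := IsPrincipalIdealRing.principal I
  by_cases hq0 : q = 0
  · refine ⟨1, one_ne_zero, fun c hc => ⟨0, ?_⟩⟩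
    rw [pow_zero]
    refine hI c ?_
    rw [hq, hq0]
    simpa using hc
  · have hqI : q ∈ I := by rw [hq]; exact Submodule.mem_span_singleton_self q
    refine ⟨w q, by simpa using hq0, fun c hc => ?_⟩
    have hunit : ¬ IsUnit q := by
      intro h
      have h1 : I = ⊤ := Ideal.eq_top_of_isUnit_mem _ hqI h
      have h2 : (1 : ℤ) ∈ I := by rw [h1]; trivial
      have h3 : w ((1 : ℤ) : K) < 1 := h2
      simp at h3
    have hfin : FiniteMultiplicity q c := Int.finiteMultiplicity_iff.2
      ⟨fun h => hunit (Int.isUnit_iff_natAbs_eq.2 h), hc⟩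
    obtain ⟨c', hc', hndvd⟩ := hfin.exists_eq_pow_mul_and_not_dvd
    refine ⟨multiplicity q c, ?_⟩
    conv_lhs => rw [hc']
    have : w (c' : K) = 1 := hI c' fun h => hndvd (by
      rw [hq] at h
      exact Ideal.mem_span_singleton.1 h)
    push_cast
    rw [map_mul, map_pow, this, mul_one]

/-- Allowing powers of `τ` costs at most one element: two relations combine to eliminate `τ`, so
dropping an `i` involved in one relation destroys all others. -/
lemma exists_subtype_valuation_ne [Fintype κ] {τ : Γ₀} (hτ : τ ≠ 0) {x : κ → K}
    (hx : ∀ j, x j ≠ 0) (hind : ∀ n : κ → ℤ, w (∏ j, x j ^ n j) = 1 → n = 0) :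
    ∃ s : Finset κ, Fintype.card κ ≤ s.card + 1 ∧
      ∀ (n : s → ℤ) (a : ℤ), w (∏ j : s, x j ^ n j) = τ ^ a → n = 0 := by
  classical
  have extend (s : Finset κ) (n : s → ℤ) :
      ∏ j : s, x j ^ n j = ∏ j, x j ^ (if h : j ∈ s then n ⟨j, h⟩ else 0) := by
    rw [← Finset.prod_subset (Finset.subset_univ s), ← Finset.prod_coe_sort s]
    · simp
    · intro j _ hj
      simp [hj]
  by_cases h : ∀ (n : κ → ℤ) (a : ℤ), w (∏ j, x j ^ n j) = τ ^ a → n = 0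
  · refine ⟨Finset.univ, by simp, fun n a hn => ?_⟩
    rw [extend] at hn
    have := h _ a hn
    ext j
    simpa using congrFun this j
  · push Not at h
    obtain ⟨m, b, hm, hm0⟩ := h
    obtain ⟨i, hi⟩ := Function.ne_iff.1 hm0
    refine ⟨Finset.univ.erase i, ?_, fun n a hn => ?_⟩
    · rw [Finset.card_erase_of_mem (Finset.mem_univ i), Finset.card_univ]
      lia
    rw [extend] at hn
    set k : κ → ℤ := fun j => if h : j ∈ Finset.univ.erase i then n ⟨j, h⟩ else 0 with hk
    have hki : k i = 0 := by simp [hk]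
    have hcomb : ∏ j, x j ^ (b * k j - a * m j) =
        (∏ j, x j ^ k j) ^ b / (∏ j, x j ^ m j) ^ a := by
      rw [← Finset.prod_zpow, ← Finset.prod_zpow, ← Finset.prod_div_distrib]
      refine Finset.prod_congr rfl fun j _ => ?_
      rw [zpow_sub₀ (hx j), ← zpow_mul, ← zpow_mul, mul_comm b, mul_comm a]
    have h0 := hind (fun j => b * k j - a * m j) (by
      rw [hcomb, map_div₀, map_zpow₀, map_zpow₀]
      change w (∏ j, x j ^ k j) ^ b / _ = 1
      rw [hn, hm, ← zpow_mul, ← zpow_mul, mul_comm b a]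
      exact div_self (zpow_ne_zero _ hτ))
    have ha : a = 0 := by
      have := congrFun h0 i
      simp only [hki, mul_zero, zero_sub, Pi.zero_apply, neg_eq_zero] at this
      exact (mul_eq_zero.1 this).resolve_right hi
    have hk0 : k = 0 := hind k (by rw [ha, zpow_zero] at hn; exact hn)
    ext j
    have := congrFun hk0 j
    simp only [hk] at this
    rwa [dif_pos j.2] at this

end Valuation

/-! ### The rational rank of a bad vector. -/

section

variable {d : ℕ} {v : EuclideanSpace ℝ (Fin d)} {p : Ideal (LaurentRing d)}

lemma exists_valuationSubring_of_not_hasContraction {K : Type*} [Field K]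
    (ψ : LaurentRing d →+* K) (h : ¬ HasContraction (RingHom.ker ψ) v) :
    ∃ V : ValuationSubring K, (∀ n : ℤ, V.valuation n ≤ 1) ∧
      ∀ n, latticeWeight v n < 0 → V.valuation (ψ (LaurentRing.monomial n)) < 1 := by
  let θ : latticeSubring (halfSpace v) →+* K := ψ.comp (latticeSubring (halfSpace v)).val.toRingHom
  have hθ : Function.Surjective θ.rangeRestrict := θ.rangeRestrict_surjective
  -- If this ideal contained `1`, some `1 - g` would lie in the kernel. Being proper, it lies in the
  -- nonunits of some valuation ring.
  have hI : (openHalfSpaceIdeal v).map θ.rangeRestrict ≠ ⊤ := by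
    rw [Ne, Ideal.eq_top_iff_one, Ideal.mem_map_iff_of_surjective _ hθ]
    rintro ⟨g, hg, hg1⟩
    refine h (hasContraction_of_sub_one_mem (r := 1 - g) (by simpa using hg) ?_)
    have : ψ g = 1 := congrArg Subtype.val hg1
    simp [RingHom.mem_ker, this]
  obtain ⟨V, -, hV⟩ := Ideal.image_subset_nonunits_valuationSubring _ hI
  refine ⟨V, fun n => (V.valuation_le_one_iff _).2 (intCast_mem V n), fun n hn => ?_⟩
  rw [← V.mem_nonunits_iff]
  have hmem : LaurentRing.monomial n ∈ latticeSubring (halfSpace v) :=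
    mem_latticeSubring_halfSpace.2 (weightLE.single_mem 1 hn.le)
  exact hV ⟨_, Ideal.mem_map_of_mem θ.rangeRestrict
    (show (⟨_, hmem⟩ : latticeSubring (halfSpace v)) ∈ openHalfSpaceIdeal v from
      ⟨_, hn, weightLE.single_mem 1 le_rfl⟩), rfl⟩

/-- The monomials, as a homomorphism from `ℤ^d` to the multiplicative monoid of `R_d`. -/
noncomputable def monomialHom (d : ℕ) : Multiplicative (Fin d → ℤ) →* LaurentRing d where
  toFun n := LaurentRing.monomial n.toAdd
  map_one' := by simp [LaurentRing.monomial, AddMonoidAlgebra.one_def]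
  map_mul' m n := by
    simp [LaurentRing.monomial, AddMonoidAlgebra.single_mul_single]

lemma prod_zpow_map_monomial {K κ : Type*} [Field K] [Fintype κ] (ψ : LaurentRing d →+* K)
    (a : κ → Fin d) (n : κ → ℤ) :
    ∏ j, ψ (LaurentRing.monomial (Pi.single (a j) 1)) ^ n j =
      ψ (LaurentRing.monomial (∑ j, n j • Pi.single (a j) 1)) := by
  let χ : Multiplicative (Fin d → ℤ) →* Kˣ :=
    ((ψ : LaurentRing d →* K).comp (monomialHom d)).toHomUnits
  have hχ : ∀ m, ((χ (Multiplicative.ofAdd m) : Kˣ) : K) = ψ (LaurentRing.monomial m) :=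
    fun m => rfl
  rw [← hχ, ofAdd_sum, map_prod, Units.coe_prod]
  refine Finset.prod_congr rfl fun j _ => ?_
  rw [ofAdd_zsmul, map_zpow, Units.val_zpow_eq_zpow_val, hχ]

/-- In characteristic `q` nonzero constants have value `1` and nothing is lost. In characteristic
zero one element may be lost to `τ`, but the extra dimension coming from `ℤ` compensates. -/
lemma natCard_le_ringKrullDim_of_ker {A : Type*} [CommRing A] [IsDomain A]
    [Algebra.FiniteType ℤ A] (K : Type*) [Field K] [Algebra A K] [IsFractionRing A K]
    (π : LaurentRing d →+* A) (h : ¬ HasContraction (RingHom.ker π) v)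
    {κ : Type*} [Fintype κ] {a : κ → Fin d} (ha : LinearIndependent ℚ fun j => v (a j)) :
    (Fintype.card κ : WithBot ℕ∞) ≤ ringKrullDim A := by
  classical
  let ψ : LaurentRing d →+* K := (algebraMap A K).comp π
  have hker : RingHom.ker ψ = RingHom.ker π := by
    ext f
    rw [RingHom.mem_ker, RingHom.comp_apply, FaithfulSMul.algebraMap_eq_zero_iff,
      RingHom.mem_ker]
  obtain ⟨V, hVint, hV⟩ := exists_valuationSubring_of_not_hasContraction ψ (hker ▸ h)
  let y : κ → A := fun j => π (LaurentRing.monomial (Pi.single (a j) 1))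
  let x : κ → K := fun j => algebraMap A K (y j)
  have hunit (n : Fin d → ℤ) : ψ (LaurentRing.monomial n) * ψ (LaurentRing.monomial (-n)) = 1 := by
    rw [← map_mul, monomial_mul_monomial_neg, map_one]
  have hx : ∀ j, x j ≠ 0 := fun j => left_ne_zero_of_mul_eq_one (hunit _)
  have hind : ∀ n : κ → ℤ, V.valuation (∏ j, x j ^ n j) = 1 → n = 0 := by
    intro n hn
    have hn' : V.valuation (ψ (LaurentRing.monomial (∑ j, n j • Pi.single (a j) 1))) = 1 := by
      rw [← prod_zpow_map_monomial]
      exact hn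
    set m : Fin d → ℤ := ∑ j, n j • Pi.single (a j) 1 with hm
    -- Nonzero weight would give `m` or `-m` a value `< 1`, whereas both have value `1`.
    have hm0 : latticeWeight v m = 0 := by
      rcases lt_trichotomy (latticeWeight v m) 0 with h0 | h0 | h0
      · exact absurd hn' (hV m h0).ne
      · exact h0
      · have h1 := hV (-m) (by rw [map_neg]; linarith)
        have h2 := congrArg V.valuation (hunit m)
        rw [map_mul, hn', one_mul, map_one] at h2
        exact absurd h2 h1.ne
    have hsum : ∑ j, (n j : ℚ) • v (a j) = 0 := by
      rw [hm, map_sum] at hm0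
      rw [← hm0]
      refine Finset.sum_congr rfl fun j _ => ?_
      have : latticeWeight v (Pi.single (a j) 1) = v (a j) := by
        rw [latticeWeight_eq_sum, Finset.sum_eq_single (a j)] <;> simp +contextual
      rw [map_zsmul, this, Rat.smul_def, zsmul_eq_mul]
      simp
    ext j
    exact_mod_cast Fintype.linearIndependent_iff.1 ha _ hsum j
  obtain ⟨q, hq⟩ := CharP.exists A
  have hqK : CharP K q := charP_of_injective_algebraMap (IsFractionRing.injective A K) q
  rcases CharP.char_is_prime_or_zero A q with hprime | hzero
  · have : Fact q.Prime := ⟨hprime⟩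
    let _ : Algebra (ZMod q) A := ZMod.algebra A q
    let _ : Algebra (ZMod q) K := ((algebraMap A K).comp (algebraMap (ZMod q) A)).toAlgebra
    have : IsScalarTower (ZMod q) A K := IsScalarTower.of_algebraMap_eq fun _ => rfl
    have : Algebra.FiniteType (ZMod q) A :=
      Algebra.FiniteType.of_restrictScalars_finiteType ℤ (ZMod q) A
    have hxind : AlgebraicIndependent (ZMod q) x := by
      refine algebraicIndependent_of_valuation V.valuation one_ne_zero hx (fun c hc => ⟨0, ?_⟩)
        (fun n a hn => hind n (by simpa using hn))
      have h1 := congrArg (fun c => V.valuation (algebraMap (ZMod q) K c))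
        (ZMod.pow_card_sub_one_eq_one hc)
      simp only [map_pow, map_one] at h1
      rw [zpow_zero]
      have hq1 := Nat.sub_ne_zero_of_lt hprime.one_lt
      exact (pow_eq_one_iff_of_nonneg zero_le hq1).1 h1
    have hyind : AlgebraicIndependent (ZMod q) y :=
      AlgebraicIndependent.of_comp (IsScalarTower.toAlgHom (ZMod q) A K) hxind
    simpa using natCard_le_ringKrullDim_of_algebraicIndependent hyind
  · subst hzero
    have : CharZero K := CharP.charP_to_charZero K
    obtain ⟨τ, hτ, hτc⟩ := exists_valuation_intCast_eq_pow V.valuation hVint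
    obtain ⟨s, hs, hsind⟩ := exists_subtype_valuation_ne V.valuation hτ hx hind
    have hxind : AlgebraicIndependent ℚ (fun j : s => x j) := by
      refine algebraicIndependent_of_valuation V.valuation hτ (fun j => hx j) (fun c hc => ?_) hsind
      obtain ⟨a, ha⟩ := hτc c.num (by simpa using hc)
      obtain ⟨b, hb⟩ := hτc c.den (by simp)
      refine ⟨a - b, ?_⟩
      rw [zpow_sub₀ hτ, zpow_natCast, zpow_natCast, ← ha, ← hb, ← map_div₀]
      congr 1
      rw [eq_ratCast]
      rw [Rat.cast_def, Int.cast_natCast]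
    have hdim := natCard_add_one_le_ringKrullDim_of_algebraicIndependent (x := fun j : s => y j) hxind
    refine le_trans ?_ hdim
    rw [Nat.card_eq_fintype_card, Fintype.card_coe]
    exact_mod_cast hs

lemma natCard_le_ringKrullDim_of_not_hasContraction [p.IsPrime] (h : ¬ HasContraction p v)
    {κ : Type*} [Fintype κ] {a : κ → Fin d} (ha : LinearIndependent ℚ fun j => v (a j)) :
    (Fintype.card κ : WithBot ℕ∞) ≤ ringKrullDim (LaurentRing d ⧸ p) := by
  have : @Algebra.FiniteType ℤ (LaurentRing d ⧸ p) _ _ (Ring.toIntAlgebra _) :=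
    have h0 : @Algebra.FiniteType ℤ (LaurentRing d) _ _ (Ring.toIntAlgebra _) := by
      rw [Subsingleton.elim (Ring.toIntAlgebra (LaurentRing d)) AddMonoidAlgebra.algebra]
      infer_instance
    @Algebra.FiniteType.of_surjective ℤ _ _ _ _ _ _ _ h0
      (Ideal.Quotient.mk p).toIntAlgHom Ideal.Quotient.mk_surjective
  exact natCard_le_ringKrullDim_of_ker (FractionRing (LaurentRing d ⧸ p)) (Ideal.Quotient.mk p)
    (by rwa [Ideal.mk_ker]) ha

/-- The rational rank of `v` is at most `k`: its coordinates lie in a `k`-dimensional `ℚ`-space. -/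
lemma exists_rat_matrix_of_not_hasContraction [p.IsPrime] (h : ¬ HasContraction p v) {k : ℕ}
    (hk : ringKrullDim (LaurentRing d ⧸ p) ≤ k) :
    ∃ (L : Fin d → Fin k → ℚ) (z : Fin k → ℝ), ∀ i, v i = ∑ j, (L i j : ℝ) * z j := by
  classical
  obtain ⟨κ, a, ha, hspan, hind⟩ := exists_linearIndependent' ℚ (fun i => v i)
  have : Fintype κ := Fintype.ofInjective a ha
  have hcard : Fintype.card κ ≤ k := by
    have := (natCard_le_ringKrullDim_of_not_hasContraction h hind).trans hk
    exact_mod_cast this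
  obtain ⟨e⟩ : Nonempty (κ ↪ Fin k) := Function.Embedding.nonempty_of_card_le (by simpa using hcard)
  have hmem : ∀ i, ∃ c : κ → ℚ, ∑ j, c j • v (a j) = v i := by
    intro i
    have : v i ∈ Submodule.span ℚ (Set.range ((fun i => v i) ∘ a)) := by
      rw [hspan]
      exact Submodule.subset_span ⟨i, rfl⟩
    exact (Submodule.mem_span_range_iff_exists_fun ℚ).1 this
  choose c hc using hmem
  -- The basis may have fewer than `k` elements; the missing columns are padded with zeros.
  refine ⟨fun i => Function.extend e (c i) 0, Function.extend e (fun j => v (a j)) 0, fun i => ?_⟩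
  rw [← hc i, ← Finset.sum_subset (Finset.subset_univ (Finset.univ.map e)), Finset.sum_map]
  · simp [e.injective.extend_apply, Rat.smul_def]
  · intro j _ hj
    rw [Function.extend_apply' _ _ _ (by simpa using hj)]
    simp

end

/-! ### Generic injectivity on countably many subspaces. -/

section Density

variable {E U : Type*} [NormedAddCommGroup E] [InnerProductSpace ℝ E] [FiniteDimensional ℝ E]
  [NormedAddCommGroup U] [InnerProductSpace ℝ U]

lemma isOpen_setOf_injective_comp_subtypeL (W : Submodule ℝ E) :
    IsOpen {h : E →L[ℝ] U | Function.Injective (h ∘L W.subtypeL)} :=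
  ContinuousLinearMap.isOpen_injective.preimage
    ((ContinuousLinearMap.compL ℝ W E U).flip W.subtypeL).continuous

/-- Perturb `h` by `t • g`, with `g` injective on `W` and `s` a left inverse of `g` there.
Injectivity on `W` can fail only if `t` is an eigenvalue of `-(s ∘ h)` on `W`, so for finitely many
`t`. -/
lemma dense_setOf_injective_comp_subtypeL (W : Submodule ℝ E)
    (hW : Module.finrank ℝ W ≤ Module.finrank ℝ U) :
    Dense {h : E →L[ℝ] U | Function.Injective (h ∘L W.subtypeL)} := by
  obtain ⟨u, hu⟩ := exists_linearIndependent_of_le_finrank hW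
  let j : W →ₗ[ℝ] U := (Module.finBasis ℝ W).constr ℝ u
  have hj : Function.Injective j :=
    (Module.finBasis ℝ W).injective_constr_of_linearIndependent hu
  obtain ⟨s, hs⟩ := j.exists_leftInverse_of_injective (LinearMap.ker_eq_bot.2 hj)
  let g : E →L[ℝ] U := LinearMap.toContinuousLinearMap j ∘L W.orthogonalProjectionOnto
  intro h
  let A : Module.End ℝ W := -(s ∘ₗ (h ∘L W.subtypeL).toLinearMap)
  have hinj (t : ℝ) (ht : ¬ A.HasEigenvalue t) :
      Function.Injective ((h + t • g) ∘L W.subtypeL) := by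
    rw [injective_iff_map_eq_zero]
    intro w hw
    by_contra hw0
    refine ht (Module.End.hasEigenvalue_of_hasEigenvector (x := w)
      ⟨Module.End.mem_eigenspace_iff.2 ?_, hw0⟩)
    have h1 : h w + t • j w = 0 := by simpa [g] using hw
    have h2 := congrArg s h1
    have h3 : s (j w) = w := LinearMap.congr_fun hs w
    rw [map_add, map_smul, h3, map_zero] at h2
    simpa [A] using neg_eq_of_add_eq_zero_right h2
  have hfin : {t : ℝ | A.HasEigenvalue t}.Finite := Module.End.finite_hasEigenvalue A
  have htend : Filter.Tendsto (fun t : ℝ => h + t • g) (nhdsWithin 0 {0}ᶜ) (nhds h) := by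
    have : Continuous fun t : ℝ => h + t • g := by fun_prop
    simpa using (this.tendsto 0).mono_left nhdsWithin_le_nhds
  refine mem_closure_of_tendsto htend ?_
  have hev : ∀ᶠ t in nhdsWithin (0 : ℝ) {0}ᶜ, t ∉ {t : ℝ | A.HasEigenvalue t} \ {0} := by
    refine nhdsWithin_le_nhds ?_
    exact (hfin.subset Set.sdiff_subset).isClosed.isOpen_compl.mem_nhds (by simp)
  filter_upwards [hev, self_mem_nhdsWithin] with t ht ht0
  exact hinj t fun h => ht ⟨h, ht0⟩

variable [FiniteDimensional ℝ U]

lemma dense_setOf_forall_injective_comp_subtypeL {ι : Type*} [Countable ι] (W : ι → Submodule ℝ E)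
    (hW : ∀ i, Module.finrank ℝ (W i) ≤ Module.finrank ℝ U) :
    Dense {h : E →L[ℝ] U | ∀ i, Function.Injective (h ∘L (W i).subtypeL)} := by
  have : CompleteSpace U := FiniteDimensional.complete ℝ U
  have h := dense_iInter_of_isOpen
    (fun i => isOpen_setOf_injective_comp_subtypeL (U := U) (W i))
    (fun i => dense_setOf_injective_comp_subtypeL (W i) (hW i))
  convert h
  ext
  simp

end Density

/-! ### Approximation and compactness in the Grassmannian. -/

section Grassmannian

variable {d k : ℕ}

lemma RealGrassmannian.edist_eq (V V' : RealGrassmannian d k) :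
    edist V V' = Metric.hausdorffEDist ((V.1 : Set (EuclideanSpace ℝ (Fin d))) ∩ Metric.sphere 0 1)
      ((V'.1 : Set (EuclideanSpace ℝ (Fin d))) ∩ Metric.sphere 0 1) := rfl

lemma norm_inv_norm_smul_sub_le {f f₀ : EuclideanSpace ℝ (Fin k) →L[ℝ] EuclideanSpace ℝ (Fin d)}
    (hf₀ : ∀ z, ‖f₀ z‖ = ‖z‖) {δ : ℝ}
    (hδ : ‖f - f₀‖ ≤ δ) {z : EuclideanSpace ℝ (Fin k)} (hz : ‖z‖ = 1) (hfz : f z ≠ 0) :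
    ‖‖f z‖⁻¹ • f z - f₀ z‖ ≤ 2 * δ := by
  have h1 : ‖f z - f₀ z‖ ≤ δ := by
    have := (f - f₀).le_of_opNorm_le hδ z
    simpa [hz] using this
  have h2 : ‖‖f z‖⁻¹ • f z - f z‖ ≤ δ := by
    have h3 : ‖f z‖⁻¹ • f z - f z = (‖f z‖⁻¹ - 1) • f z := by rw [sub_smul, one_smul]
    have h4 : ‖f z‖ ≠ 0 := norm_ne_zero_iff.2 hfz
    rw [h3, norm_smul, ← norm_norm (f z), ← norm_mul, norm_norm, sub_mul, one_mul,
      inv_mul_cancel₀ h4, ← hz, ← hf₀ z, norm_sub_rev]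
    exact (abs_norm_sub_norm_le _ _).trans h1
  calc _ = ‖(‖f z‖⁻¹ • f z - f z) + (f z - f₀ z)‖ := by rw [sub_add_sub_cancel]
    _ ≤ δ + δ := (norm_add_le _ _).trans (add_le_add h2 h1)
    _ = 2 * δ := by ring

lemma hausdorffEDist_range_le {f f₀ : EuclideanSpace ℝ (Fin k) →L[ℝ] EuclideanSpace ℝ (Fin d)}
    (hf₀ : ∀ z, ‖f₀ z‖ = ‖z‖) {δ : ℝ}
    (hδ : ‖f - f₀‖ ≤ δ) (hf : Function.Injective f) :
    Metric.hausdorffEDist ((LinearMap.range f.toLinearMap : Set (EuclideanSpace ℝ (Fin d))) ∩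
        Metric.sphere 0 1)
      ((LinearMap.range f₀.toLinearMap : Set (EuclideanSpace ℝ (Fin d))) ∩ Metric.sphere 0 1) ≤
        ENNReal.ofReal (2 * δ) := by
  have hne {z : EuclideanSpace ℝ (Fin k)} (hz : z ≠ 0) : f z ≠ 0 := fun h => hz (hf (by rw [h, map_zero]))
  refine Metric.hausdorffEDist_le_of_mem_edist ?_ ?_
  · rintro _ ⟨⟨y, rfl⟩, hy⟩
    have hy1 : ‖f y‖ = 1 := by simpa using hy
    have hy0 : y ≠ 0 := by rintro rfl; simp at hy1
    have hyn : ‖y‖ ≠ 0 := norm_ne_zero_iff.2 hy0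
    have hz : ‖‖y‖⁻¹ • y‖ = 1 := by
      rw [norm_smul, norm_inv, norm_norm, inv_mul_cancel₀ hyn]
    refine ⟨f₀ (‖y‖⁻¹ • y), ⟨⟨_, rfl⟩, by rw [mem_sphere_zero_iff_norm, hf₀, hz]⟩, ?_⟩
    have h := norm_inv_norm_smul_sub_le hf₀ hδ hz (hne (norm_ne_zero_iff.1 (by rw [hz]; simp)))
    have heq : ‖f (‖y‖⁻¹ • y)‖⁻¹ • f (‖y‖⁻¹ • y) = f y := by
      rw [map_smul, norm_smul, hy1, mul_one, norm_inv, norm_norm, inv_inv, smul_smul,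
        mul_inv_cancel₀ hyn, one_smul]
    rw [heq] at h
    rw [edist_dist, dist_eq_norm]
    exact ENNReal.ofReal_le_ofReal h
  · rintro _ ⟨⟨z, rfl⟩, hz⟩
    have hz1 : ‖z‖ = 1 := by
      rw [← hf₀ z]; simpa using hz
    have hfz : f z ≠ 0 := hne (norm_ne_zero_iff.1 (by rw [hz1]; simp))
    refine ⟨‖f z‖⁻¹ • f z, ⟨⟨‖f z‖⁻¹ • z, by simp⟩, ?_⟩, ?_⟩
    · simp [norm_smul, inv_mul_cancel₀ (norm_ne_zero_iff.2 hfz)]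
    · rw [edist_comm, edist_dist, dist_eq_norm]
      exact ENNReal.ofReal_le_ofReal (norm_inv_norm_smul_sub_le hf₀ hδ hz1 hfz)

/-- The `k`-planes whose orthogonal complements meet each of countably many subspaces of dimension
at most `k` trivially are dense. -/
lemma RealGrassmannian.exists_near_disjoint_orthogonal {ι : Type*} [Countable ι]
    (W : ι → Submodule ℝ (EuclideanSpace ℝ (Fin d))) (hW : ∀ i, Module.finrank ℝ (W i) ≤ k) (V₀ : RealGrassmannian d k)
    {ε : ENNReal} (hε : 0 < ε) :
    ∃ V : RealGrassmannian d k, edist V V₀ < ε ∧ ∀ i, Disjoint V.1ᗮ (W i) := by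
  obtain ⟨r, hr0, hr⟩ := ENNReal.lt_iff_exists_nnreal_btwn.1 hε
  have hr0' : (0 : ℝ) < r := by exact_mod_cast hr0
  let b := (stdOrthonormalBasis ℝ V₀.1).reindex (finCongr V₀.2)
  let i₀ : EuclideanSpace ℝ (Fin k) →ₗᵢ[ℝ] EuclideanSpace ℝ (Fin d) := V₀.1.subtypeₗᵢ.comp b.repr.symm.toLinearIsometry
  let f₀ : EuclideanSpace ℝ (Fin k) →L[ℝ] EuclideanSpace ℝ (Fin d) := i₀.toContinuousLinearMap
  have hf₀ : ∀ z, ‖f₀ z‖ = ‖z‖ := i₀.norm_map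
  have hrange : LinearMap.range f₀.toLinearMap = V₀.1 := by
    ext x
    constructor
    · rintro ⟨z, rfl⟩
      exact (b.repr.symm z).2
    · intro hx
      exact ⟨b.repr ⟨x, hx⟩, by simp [f₀, i₀]⟩
  -- The plane sought is the range of the adjoint of `h`, whose orthogonal complement is the kernel
  -- of `h`. The bound `1 / 2` keeps that adjoint injective; `r / 2` absorbs the factor `2` in
  -- `hausdorffEDist_range_le`.
  obtain ⟨h, hh, hdist⟩ := (dense_setOf_forall_injective_comp_subtypeL (U := EuclideanSpace ℝ (Fin k)) W
    (by simpa using hW)).exists_dist_lt (ContinuousLinearMap.adjoint f₀)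
    (show (0 : ℝ) < min (1 / 2) ((r : ℝ) / 2) from lt_min (by norm_num) (by linarith))
  let f : EuclideanSpace ℝ (Fin k) →L[ℝ] EuclideanSpace ℝ (Fin d) := ContinuousLinearMap.adjoint h
  have hnorm : ‖f - f₀‖ < min (1 / 2) (r / 2 : ℝ) := by
    rw [dist_comm, dist_eq_norm, ← LinearIsometryEquiv.norm_map ContinuousLinearMap.adjoint,
      map_sub, ContinuousLinearMap.adjoint_adjoint] at hdist
    exact hdist
  have hf : Function.Injective f := by
    rw [injective_iff_map_eq_zero]
    intro z hz
    have h1 := (f - f₀).le_of_opNorm_le (hnorm.le.trans (min_le_left _ _)) z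
    rw [sub_apply, hz, zero_sub, norm_neg, hf₀] at h1
    exact norm_le_zero_iff.1 (by linarith)
  let V : RealGrassmannian d k := ⟨LinearMap.range f.toLinearMap, by
    rw [LinearMap.finrank_range_of_inj hf]
    simp⟩
  refine ⟨V, ?_, fun i => ?_⟩
  · rw [RealGrassmannian.edist_eq, ← hrange]
    refine (hausdorffEDist_range_le hf₀ (hnorm.le.trans (min_le_right _ _)) hf).trans_lt ?_
    rwa [mul_div_cancel₀ _ two_ne_zero, ENNReal.ofReal_coe_nnreal]
  · rw [Submodule.disjoint_def]
    intro x hx hxW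
    have h1 : h x = 0 := by
      refine ext_inner_left ℝ fun z => ?_
      rw [inner_zero_right, ← ContinuousLinearMap.adjoint_inner_left]
      exact (Submodule.mem_orthogonal _ _).1 hx (f z) ⟨z, rfl⟩
    have h2 : (⟨x, hxW⟩ : W i) = 0 := (injective_iff_map_eq_zero _).1 (hh i) _ (by simpa using h1)
    exact congrArg Subtype.val h2

lemma mem_orthogonal_of_subset_halfSpace {V : Submodule ℝ (EuclideanSpace ℝ (Fin d))} {v : EuclideanSpace ℝ (Fin d)}
    (h : (V : Set (EuclideanSpace ℝ (Fin d))) ⊆ halfSpace v) : v ∈ Vᗮ := by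
  rw [Submodule.mem_orthogonal]
  intro x hx
  have h1 : inner ℝ x v ≤ 0 := h hx
  have h2 : inner ℝ (-x) v ≤ 0 := h (V.neg_mem hx)
  rw [inner_neg_left] at h2
  linarith

lemma isClosed_setOf_exists_subset_halfSpace {C : Set (EuclideanSpace ℝ (Fin d))} (hC : IsClosed C) :
    IsClosed {V : RealGrassmannian d k |
      ∃ v ∈ Metric.sphere (0 : EuclideanSpace ℝ (Fin d)) 1, (V.1 : Set (EuclideanSpace ℝ (Fin d))) ⊆ halfSpace v ∧ v ∈ C} := by
  refine IsSeqClosed.isClosed fun V V₀ hV hlim => ?_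
  choose v hv hVv hvC using hV
  obtain ⟨v₀, hv₀, φ, hφ, hlimv⟩ := (isCompact_sphere (0 : EuclideanSpace ℝ (Fin d)) 1).tendsto_subseq hv
  refine ⟨v₀, hv₀, ?_, hC.mem_of_tendsto hlimv (Filter.Eventually.of_forall fun n => hvC _)⟩
  have hunit : ∀ x ∈ V₀.1, ‖x‖ = 1 → inner ℝ x v₀ ≤ 0 := by
    intro x hx hx1
    have hlimx : Filter.Tendsto (fun n => inner ℝ x (v (φ n))) Filter.atTop (nhds (inner ℝ x v₀)) :=
      tendsto_const_nhds.inner hlimv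
    refine le_of_forall_pos_le_add fun ε hε => ?_
    rw [zero_add]
    refine le_of_tendsto hlimx ?_
    have hev := (hlim.comp hφ.tendsto_atTop).eventually
      (Metric.eball_mem_nhds V₀ (ENNReal.ofReal_pos.2 hε))
    filter_upwards [hev] with n hn
    have hn' : edist V₀ (V (φ n)) < ENNReal.ofReal ε := by rw [edist_comm]; exact hn
    rw [RealGrassmannian.edist_eq] at hn'
    obtain ⟨y, ⟨hy, -⟩, hxy⟩ := Metric.exists_edist_lt_of_hausdorffEDist_lt
      (show x ∈ (V₀.1 : Set (EuclideanSpace ℝ (Fin d))) ∩ Metric.sphere 0 1 from ⟨hx, by simpa using hx1⟩) hn'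
    rw [edist_dist, ENNReal.ofReal_lt_ofReal_iff hε, dist_eq_norm] at hxy
    have h1 : inner ℝ y (v (φ n)) ≤ 0 := hVv _ hy
    have h2 : inner ℝ (x - y) (v (φ n)) ≤ ‖x - y‖ * ‖v (φ n)‖ := real_inner_le_norm _ _
    have h3 : ‖v (φ n)‖ = 1 := by simpa using hv (φ n)
    rw [h3, mul_one, inner_sub_left] at h2
    linarith
  intro x hx
  change inner ℝ x v₀ ≤ 0
  rcases eq_or_ne x 0 with rfl | hx0
  · simp
  have hn : 0 < ‖x‖ := norm_pos_iff.2 hx0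
  have h := hunit (‖x‖⁻¹ • x) (V₀.1.smul_mem _ hx)
    (by rw [norm_smul, norm_inv, norm_norm, inv_mul_cancel₀ hn.ne'])
  rw [real_inner_smul_left] at h
  exact nonpos_of_mul_nonpos_right h (inv_pos.2 hn)

end Grassmannian

/-! ### Conclusion. -/

section

variable {d k : ℕ} {M : Type*} [AddCommGroup M] [Module (LaurentRing d) M]
  [IsNoetherian (LaurentRing d) M]

lemma mem_nonNoetherianPlanes_iff {V : RealGrassmannian d k} :
    V ∈ nonNoetherianPlanes d k M ↔ ∃ v ∈ Metric.sphere (0 : EuclideanSpace ℝ (Fin d)) 1,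
      (V.1 : Set (EuclideanSpace ℝ (Fin d))) ⊆ halfSpace v ∧
        v ∈ {v | HasContraction (Module.annihilator (LaurentRing d) M) v}ᶜ := by
  change ¬ IsNoetherianAlong M V.1 ↔ _
  unfold IsNoetherianAlong
  push Not
  refine exists_congr fun v => and_congr_right fun hv => and_congr_right fun _ => ?_
  rw [isHalfSpaceNoetherian_iff (ne_zero_of_mem_unit_sphere ⟨v, hv⟩)]
  rfl

end

/-- The column space of a rational matrix. -/
noncomputable def ratColumnSpace {d k : ℕ} (L : Fin d → Fin k → ℚ) :
    Submodule ℝ (EuclideanSpace ℝ (Fin d)) :=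
  LinearMap.range ((WithLp.linearEquiv 2 ℝ (Fin d → ℝ)).symm.toLinearMap ∘ₗ
    Matrix.mulVecLin (Matrix.of fun i j => (L i j : ℝ)))

lemma finrank_ratColumnSpace_le {d k : ℕ} (L : Fin d → Fin k → ℚ) :
    Module.finrank ℝ (ratColumnSpace L) ≤ k :=
  (LinearMap.finrank_range_le _).trans (by simp)

lemma mem_ratColumnSpace {d k : ℕ} {L : Fin d → Fin k → ℚ} {v : EuclideanSpace ℝ (Fin d)}
    {z : Fin k → ℝ} (h : ∀ i, v i = ∑ j, (L i j : ℝ) * z j) : v ∈ ratColumnSpace L := by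
  refine ⟨z, ?_⟩
  ext i
  simp [h i, Matrix.mulVec, dotProduct]

theorem proposition8p5 (d k : ℕ) (hk : k ≤ d)
    (M : Type*) [AddCommGroup M] [Module (LaurentRing d) M] [IsNoetherian (LaurentRing d) M]
    (hdim : ∀ p ∈ associatedPrimes (LaurentRing d) M,
      ringKrullDim (LaurentRing d ⧸ p) ≤ (k : WithBot ℕ∞)) :
    IsClosed (nonNoetherianPlanes d k M) ∧ interior (nonNoetherianPlanes d k M) = ∅ := by
  constructor
  · have h := isClosed_setOf_exists_subset_halfSpace (k := k)
      (isOpen_setOf_hasContraction (Module.annihilator (LaurentRing d) M)).isClosed_compl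
    convert h
    ext V
    exact mem_nonNoetherianPlanes_iff
  · rw [Set.eq_empty_iff_forall_notMem]
    intro V₀ hV₀
    obtain ⟨ε, hε, hball⟩ := EMetric.mem_nhds_iff.1 (mem_interior_iff_mem_nhds.1 hV₀)
    obtain ⟨V, hV, hdisj⟩ := RealGrassmannian.exists_near_disjoint_orthogonal
      ratColumnSpace finrank_ratColumnSpace_le V₀ hε
    obtain ⟨v, hv, hVv, hvC⟩ := mem_nonNoetherianPlanes_iff.1 (hball hV)
    obtain ⟨p, hp, hpv⟩ := exists_associatedPrime_not_hasContraction hvC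
    have : p.IsPrime := hp.isPrime
    obtain ⟨L, z, hL⟩ := exists_rat_matrix_of_not_hasContraction hpv (hdim p hp)
    exact ne_zero_of_mem_unit_sphere ⟨v, hv⟩ (Submodule.disjoint_def.1 (hdisj L) v
      (mem_orthogonal_of_subset_halfSpace hVv) (mem_ratColumnSpace hL))
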